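/- **Setting.** Let $D \ge 1$ and $d_\star \le D$. Let $\mathcal X \subset \mathbb R^D$ be finite with $\operatorname{span}(\mathcal X)=\mathbb R^D$, let $\mathcal Z \subset \mathbb R^D$, and let $\theta_\star \in \Theta_{d_\star} = \{\theta \in \mathbb R^D : \theta_i = 0 \ \forall i > d_\star\}$. Put $h(x) = \langle \theta_\star, x\rangle$. Assume that $h$ has a unique maximizer $z_\star$ over $\mathcal Z$, and that $\operatorname{span}\{z_\star - z : z \in \mathcal Z\} = \mathbb R^D$. For $d \le D$ let $\psi_d(x) \in \mathbb R^d$ consist of the first $d$ coordinates of $x$, let $\Delta_{\mathcal X}$ be the probability simplex over $\mathcal X$, let $A_d(\lambda) = \sum_{x\in\mathcal X} \lambda_x \psi_d(x)\psi_d(x)^\top$ for $\lambda\in\Delta_{\mathcal X}$, and let $$\rho^\star_d = \inf_{\lambda \in \Delta_{\mathcal X}} \ \sup_{z \in \mathcal Z\setminus\{z_\star\}} \frac{\|\psi_d(z_\star) - \psi_d(z)\|^2_{A_d(\lambda)^{-1}}}{(h(z_\star) - h(z))^2},$$ where $\|y\|^2_{A^{-1}} = y^\top A^{+} y$ with the pseudo-inverse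 $A^+$ if $y$ is in the range of $A$, and $\|y\|^2_{A^{-1}} = \infty$ otherwise. A *non-interactive algorithm* with feature dimension $d$, where $d_\star \le d \le D$, fixes $N$ and an allocation $x_1,\dots,x_N \in \mathcal X$ (possibly with knowledge of $\theta_\star$), observes independent rewards $r_i \sim \mathcal N(h(x_i),1)$, computes the least-squares estimator $\hat\theta_d = \operatorname{argmin}_{\theta\in\mathbb R^d} \sum_{i=1}^N (r_i - \langle\theta, \psi_d(x_i)\rangle)^2$, and recommends $\hat z \in \operatorname{argmax}_{z\in\mathcal Z} \langle \hat\theta_d, \psi_d(z)\rangle$, ties broken arbitrarily. **Theorem.** Let $\delta \in (0, 0.015]$ and $N \le \tfrac12\, \rho^\star_{d_\star} \log(1/\delta)$. 1. If the least-squares problem has a unique solution $\hat\theta_d$, then the algorithm makes a mistake with probability at least $\delta$, that is, $\mathbb P(\hat z \ne z_\star) \ge \delta$. 2. For every allocation, also when the least-squares problem has several solutions, with probability at least $\delta$ there is a least-squares solution $\hat\theta_d$ for which $z_\star$ is not the unique maximizer of $\langle \hat\theta_d, \psi_d(z)\rangle$ over $z \in \mathcal Z$. -/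

import Mathlib

open MeasureTheory ProbabilityTheory
open scoped ENNReal

noncomputable section

namespace LinearBandit

/-- The truncation `ψ_d : ℝ^D → ℝ^d` keeping the first `d` coordinates. -/
def truncate {d D : ℕ} (hd : d ≤ D) (x : EuclideanSpace ℝ (Fin D)) : EuclideanSpace ℝ (Fin d) :=
  WithLp.toLp 2 fun i => x (Fin.castLE hd i)

/-- The parameter space `Θ_d`: all coordinates after the first `d` vanish. -/
def paramSpace (D d : ℕ) : Set (EuclideanSpace ℝ (Fin D)) :=
  {θ | ∀ i : Fin D, d ≤ (i : ℕ) → θ i = 0}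

/-- The design matrix `A_d(λ) = ∑_{x ∈ X} λ_x ψ_d(x) ψ_d(x)ᵀ`. -/
def designMatrix {d D : ℕ} (hd : d ≤ D) (X : Finset (EuclideanSpace ℝ (Fin D)))
    (l : X → ℝ) : Matrix (Fin d) (Fin d) ℝ :=
  ∑ x : X, l x • Matrix.vecMulVec (truncate hd x.1) (truncate hd x.1)

/-- `‖y‖²_{A⁻¹}` for a symmetric positive semidefinite matrix `A`, with values in `[0, ∞]`:
it is `∞` when `y` is not in the range of `A`; when `y = A w` it is `wᵀ y = yᵀ A⁺ y`, which does
not depend on the choice of `w` (see `invNormSq_of_range`, `invNormSq_of_not_range`). -/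
def invNormSq {d : ℕ} (A : Matrix (Fin d) (Fin d) ℝ) (y : Fin d → ℝ) : ℝ≥0∞ :=
  ⨅ (w : Fin d → ℝ) (_ : A.mulVec w = y), ENNReal.ofReal (w ⬝ᵥ y)

/-- On the range of `A`, `invNormSq` is `yᵀ G y` for every generalized inverse `G` of `A`
(`A G A = A`), in particular for the Moore-Penrose pseudo-inverse and, if `A` is invertible,
for `A⁻¹`. -/
theorem invNormSq_of_range {d : ℕ} {A G : Matrix (Fin d) (Fin d) ℝ} (hA : A.transpose = A)
    (hG : A * G * A = A) {y : Fin d → ℝ} (hy : ∃ w, A.mulVec w = y) :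
    invNormSq A y = ENNReal.ofReal (y ⬝ᵥ G.mulVec y) := by
  have key : ∀ w : Fin d → ℝ, A.mulVec w = y → w ⬝ᵥ y = y ⬝ᵥ G.mulVec y := by
    intro w hw
    have h1 : y = A.mulVec (G.mulVec y) := by
      rw [← hw, Matrix.mulVec_mulVec, Matrix.mulVec_mulVec, hG]
    calc w ⬝ᵥ y = w ⬝ᵥ A.mulVec (G.mulVec y) := by rw [← h1]
      _ = Matrix.vecMul w A ⬝ᵥ G.mulVec y := Matrix.dotProduct_mulVec _ _ _
      _ = y ⬝ᵥ G.mulVec y := by rw [← Matrix.mulVec_transpose, hA, hw]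
  obtain ⟨w, hw⟩ := hy
  unfold invNormSq
  apply le_antisymm
  · exact (iInf₂_le w hw).trans (by rw [key w hw])
  · exact le_iInf₂ fun v hv => by rw [key v hv]

/-- Outside the range of `A`, `invNormSq` is infinite. -/
theorem invNormSq_of_not_range {d : ℕ} {A : Matrix (Fin d) (Fin d) ℝ} {y : Fin d → ℝ}
    (hy : ¬ ∃ w, A.mulVec w = y) : invNormSq A y = ⊤ := by
  simp only [not_exists] at hy
  simp [invNormSq, hy]

/-- The complexity
`ρ*_d = inf_{λ ∈ Δ_X} sup_{z ∈ Z, z ≠ z*} ‖ψ_d(z*) - ψ_d(z)‖²_{A_d(λ)⁻¹} / (h(z*) - h(z))²`,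
where `h(z) = ⟨θ*, z⟩`. -/
def rhoStar {d D : ℕ} (hd : d ≤ D) (X : Finset (EuclideanSpace ℝ (Fin D)))
    (Z : Set (EuclideanSpace ℝ (Fin D))) (θs zs : EuclideanSpace ℝ (Fin D)) : ℝ≥0∞ :=
  ⨅ l ∈ stdSimplex ℝ X, ⨆ z ∈ Z \ {zs},
    invNormSq (designMatrix hd X l) (truncate hd zs - truncate hd z)
      / ENNReal.ofReal ((inner ℝ θs zs - inner ℝ θs z) ^ 2)

/-- The set `argmin_{θ ∈ ℝ^d} ∑ i, (r i - ⟨θ, ψ_d(x i)⟩)²` of least-squares solutions. -/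
def leastSquares {d D N : ℕ} (hd : d ≤ D) (x : Fin N → EuclideanSpace ℝ (Fin D))
    (r : Fin N → ℝ) : Set (EuclideanSpace ℝ (Fin d)) :=
  {θ | ∀ θ' : EuclideanSpace ℝ (Fin d),
    ∑ i, (r i - inner ℝ θ (truncate hd (x i))) ^ 2
      ≤ ∑ i, (r i - inner ℝ θ' (truncate hd (x i))) ^ 2}

/-- The set `argmax_{z ∈ Z} ⟨θ, ψ_d(z)⟩` of arms that the parameter `θ ∈ ℝ^d` recommends. -/
def bestArms {d D : ℕ} (hd : d ≤ D) (Z : Set (EuclideanSpace ℝ (Fin D)))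
    (θ : EuclideanSpace ℝ (Fin d)) : Set (EuclideanSpace ℝ (Fin D)) :=
  {z | z ∈ Z ∧ ∀ z' ∈ Z, inner ℝ θ (truncate hd z') ≤ inner ℝ θ (truncate hd z)}

end LinearBandit

end

/-!
The least-squares estimator is linear in the rewards. When it is unique, the estimated gap
`⟨θ̂, ψ_d(z⋆ - z)⟩` equals `⟨r, a⟩` for an `a ∈ ℝ^N` with `∑ i, a i • ψ_d(x i) = ψ_d(z⋆ - z)`. It is
therefore Gaussian, with variance `‖a‖²` and, since `d ≥ d⋆`, with mean the true gap
`h(z⋆) - h(z)`. Truncating the equation for `a` to `d⋆` coordinates shows that `N ‖a‖²` is at least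
`‖ψ_{d⋆}(z⋆ - z)‖²_{A⁻¹}` for the empirical design, whichever `d ≥ d⋆` the algorithm uses. Hence
`N < t² ρ⋆` yields an arm `z` whose gap is less than `t ‖a‖`, and its estimated gap is negative with
probability at least the standard Gaussian mass of `(-∞, -t)`.

When the least-squares problem is degenerate, its solution set is a translate of a nonzero subspace.
Since the vectors `ψ_d(z⋆ - z)` span, moving along that subspace makes one of the estimated gaps
negative, whatever the rewards are.

The statement with `δ` is the case `t² = log (1 / δ) / 2`: the Gaussian mass of `(-∞, -t)` is at
least the density at `-(t + 1)`, which for `t² ≥ 2`, that is `δ ≤ exp (-4)`, exceeds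
`exp (-2 t²) = δ`.
-/

namespace LinearBandit

open scoped NNReal

section Gaussian

theorem measureReal_Iio_le_of_forall_lt {α : Type*} [LinearOrder α] [TopologicalSpace α]
    [OrderTopology α] [DenselyOrdered α] [NoMinOrder α] [FirstCountableTopology α]
    [MeasurableSpace α] {μ : Measure α} [IsFiniteMeasure μ] {a : α} {c : ℝ}
    (h : ∀ b < a, μ.real (Set.Iio b) ≤ c) : μ.real (Set.Iio a) ≤ c := by
  obtain ⟨u, hu_mono, hu_lt, hu_tendsto⟩ := exists_seq_strictMono_tendsto a
  have hlub : IsLUB (Set.range u) a := isLUB_of_tendsto_atTop hu_mono.monotone hu_tendsto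
  have hlim : Filter.Tendsto (fun n => μ.real (Set.Iio (u n))) Filter.atTop
      (nhds (μ.real (Set.Iio a))) := by
    rw [← hlub.iUnion_Iio_eq]
    exact (ENNReal.tendsto_toReal (measure_ne_top μ _)).comp
      (tendsto_measure_iUnion_atTop hu_mono.monotone.Iio)
  exact le_of_tendsto' hlim fun n => h _ (hu_lt n)

theorem gaussianPDFReal_monotoneOn_Iic (m : ℝ) (v : ℝ≥0) :
    MonotoneOn (gaussianPDFReal m v) (Set.Iic m) := by
  intro x hx y hy hxy
  rw [Set.mem_Iic] at hx hy
  have hsq : (y - m) ^ 2 ≤ (x - m) ^ 2 :=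
    sq_le_sq.2 <| abs_le_abs_of_nonpos (by linarith) (by linarith)
  simp only [gaussianPDFReal, neg_div]
  gcongr

theorem sub_mul_gaussianPDFReal_le_gaussianReal_Iio {m a b : ℝ} {v : ℝ≥0} (hab : a ≤ b)
    (hbm : b ≤ m) :
    (b - a) * gaussianPDFReal m v a ≤ (gaussianReal m v).real (Set.Iio b) := by
  rcases eq_or_ne v 0 with rfl | hv
  · simp
  calc (b - a) * gaussianPDFReal m v a
      = ∫ _ in Set.Ioo a b, gaussianPDFReal m v a := by simp [hab]
    _ ≤ ∫ x in Set.Ioo a b, gaussianPDFReal m v x :=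
        setIntegral_mono_on (by simp) (integrable_gaussianPDFReal m v).integrableOn
          measurableSet_Ioo fun x hx => gaussianPDFReal_monotoneOn_Iic m v (hab.trans hbm)
            (hx.2.le.trans hbm) hx.1.le
    _ = (gaussianReal m v).real (Set.Ioo a b) := by
        rw [measureReal_def, gaussianReal_apply_eq_integral m hv,
          ENNReal.toReal_ofReal (integral_nonneg fun x => gaussianPDFReal_nonneg m v x)]
    _ ≤ (gaussianReal m v).real (Set.Iio b) := measureReal_mono Set.Ioo_subset_Iio_self

theorem exp_neg_two_mul_sq_le_gaussianReal_Iio_neg {t : ℝ} (ht : √2 ≤ t) :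
    Real.exp (-(2 * t ^ 2)) ≤ (gaussianReal 0 1).real (Set.Iio (-t)) := by
  have ht0 : 0 ≤ t := (Real.sqrt_nonneg 2).trans ht
  have ht_sq : 2 ≤ t ^ 2 := (Real.sqrt_le_left ht0).1 ht
  have hroot : √(2 * Real.pi) ≤ Real.exp 1 := by
    refine Real.sqrt_le_iff.2 ⟨by positivity, ?_⟩
    nlinarith [Real.pi_lt_d2, Real.exp_one_gt_d9]
  have hexponent : 1 - 2 * t ^ 2 ≤ -(t + 1) ^ 2 / 2 := by nlinarith [sq_nonneg (t - 1.4)]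
  calc Real.exp (-(2 * t ^ 2))
      ≤ (√(2 * Real.pi))⁻¹ * Real.exp (-(t + 1) ^ 2 / 2) := by
        rw [inv_mul_eq_div, le_div_iff₀ (by positivity)]
        calc Real.exp (-(2 * t ^ 2)) * √(2 * Real.pi)
            ≤ Real.exp (-(2 * t ^ 2)) * Real.exp 1 := by gcongr
          _ = Real.exp (1 - 2 * t ^ 2) := by rw [← Real.exp_add, neg_add_eq_sub]
          _ ≤ Real.exp (-(t + 1) ^ 2 / 2) := Real.exp_le_exp.2 hexponent
    _ = (-t - (-(t + 1))) * gaussianPDFReal 0 1 (-(t + 1)) := by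
        rw [neg_sub_neg, add_sub_cancel_left, one_mul]
        simp [gaussianPDFReal, -neg_add_rev]
    _ ≤ (gaussianReal 0 1).real (Set.Iio (-t)) :=
        sub_mul_gaussianPDFReal_le_gaussianReal_Iio (by linarith) (by linarith)

theorem le_gaussianReal_Iio_neg_sqrt_log {δ : ℝ} (hδ0 : 0 < δ) (hδ1 : δ ≤ 0.015) :
    δ ≤ (gaussianReal 0 1).real (Set.Iio (-√(Real.log (1 / δ) / 2))) := by
  have hlog : 4 ≤ Real.log (1 / δ) := by
    rw [Real.le_log_iff_exp_le (by positivity), le_div_iff₀ hδ0]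
    calc Real.exp 4 * δ = Real.exp 1 ^ 4 * δ := by rw [← Real.exp_nat_mul]; norm_num
      _ ≤ 2.72 ^ 4 * 0.015 := by
        gcongr
        linarith [Real.exp_one_lt_d9]
      _ ≤ 1 := by norm_num
  calc δ = Real.exp (-(2 * √(Real.log (1 / δ) / 2) ^ 2)) := by
        rw [Real.sq_sqrt (by linarith), mul_div_cancel₀ _ two_ne_zero, one_div, Real.log_inv,
          neg_neg, Real.exp_log hδ0]
    _ ≤ _ := exp_neg_two_mul_sq_le_gaussianReal_Iio_neg (Real.sqrt_le_sqrt (by linarith))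

theorem gaussianReal_Iio_neg_le_gaussianReal_Iio_zero {m s t : ℝ} (hs : 0 < s)
    (hm : m ≤ t * s) :
    (gaussianReal 0 1).real (Set.Iio (-t)) ≤
      (gaussianReal m (.mk (s ^ 2) (sq_nonneg s))).real (Set.Iio 0) := by
  have hlaw := gaussianReal_add_const
    (gaussianReal_const_mul (HasLaw.id (μ := gaussianReal 0 1)) s) m
  simp only [mul_zero, zero_add, mul_one, id_eq] at hlaw
  calc (gaussianReal 0 1).real (Set.Iio (-t))
      ≤ (gaussianReal 0 1).real {x | s * x + m < 0} := by
        refine measureReal_mono fun x (hx : x < -t) => ?_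
        have : s * x < s * -t := by gcongr
        rw [Set.mem_ofPred_eq]
        linarith
    _ = (gaussianReal m (.mk (s ^ 2) (sq_nonneg s))).real (Set.Iio 0) :=
        hlaw.measureReal_eq measurableSet_Iio

variable {ι Ω : Type*} [Fintype ι] [MeasurableSpace Ω] {P : Measure Ω} {X : ι → Ω → ℝ}
  {m : ι → ℝ}

theorem hasLaw_sum_gaussianReal {v : ι → ℝ≥0} (hindep : iIndepFun X P)
    (hlaw : ∀ i, HasLaw (X i) (gaussianReal (m i) (v i)) P) :
    HasLaw (fun ω => ∑ i, X i ω) (gaussianReal (∑ i, m i) (∑ i, v i)) P := by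
  have := hindep.isProbabilityMeasure
  have hX : ∀ i, AEMeasurable (X i) P := fun i => (hlaw i).aemeasurable
  refine ⟨by fun_prop, Measure.ext_of_charFun ?_⟩
  ext s
  rw [hindep.charFun_map_fun_sum_eq_prod hX, Finset.prod_apply]
  simp only [(hlaw _).map_eq, charFun_gaussianReal, ← Complex.exp_sum]
  push_cast
  simp only [Finset.sum_sub_distrib, Finset.mul_sum, Finset.sum_mul, Finset.sum_div]

theorem hasLaw_inner_gaussianReal (hindep : iIndepFun X P)
    (hlaw : ∀ i, HasLaw (X i) (gaussianReal (m i) 1) P) (a : EuclideanSpace ℝ ι) :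
    HasLaw (fun ω => inner ℝ (WithLp.toLp 2 fun i => X i ω) a)
      (gaussianReal (inner ℝ (WithLp.toLp 2 m) a) (.mk (‖a‖ ^ 2) (sq_nonneg ‖a‖))) P := by
  have hsum := hasLaw_sum_gaussianReal (hindep.comp (fun i y => a i * y) (by fun_prop))
    fun i => gaussianReal_const_mul (hlaw i) (a i)
  convert hsum using 2
  · simp [PiLp.inner_apply]
  · simp [PiLp.inner_apply]
  · exact NNReal.eq (by simp [EuclideanSpace.norm_sq_eq])

theorem gaussianReal_Iio_neg_le_measureReal_inner_lt_zero (hindep : iIndepFun X P)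
    (hlaw : ∀ i, HasLaw (X i) (gaussianReal (m i) 1) P) {a : EuclideanSpace ℝ ι} (ha : a ≠ 0)
    {t : ℝ} (ht : inner ℝ (WithLp.toLp 2 m) a ≤ t * ‖a‖) :
    (gaussianReal 0 1).real (Set.Iio (-t)) ≤
      P.real {ω | inner ℝ (WithLp.toLp 2 fun i => X i ω) a < 0} :=
  (gaussianReal_Iio_neg_le_gaussianReal_Iio_zero (norm_pos_iff.2 ha) ht).trans_eq
    ((hasLaw_inner_gaussianReal hindep hlaw a).measureReal_eq measurableSet_Iio).symm

end Gaussian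

section NormalEquations

variable {E F : Type*} [NormedAddCommGroup E] [InnerProductSpace ℝ E] [FiniteDimensional ℝ E]
  [NormedAddCommGroup F] [InnerProductSpace ℝ F] [FiniteDimensional ℝ F]

theorem exists_adjoint_apply_apply_eq (T : E →ₗ[ℝ] F) (a : F) :
    ∃ u, T.adjoint (T u) = T.adjoint a ∧ ‖T u‖ ≤ ‖a‖ := by
  obtain ⟨u, hu⟩ := (LinearMap.range T).starProjection_apply_mem a
  refine ⟨u, ext_inner_right ℝ fun v => ?_, hu ▸ (LinearMap.range T).norm_starProjection_apply_le a⟩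
  have horth := (LinearMap.range T).starProjection_inner_eq_zero a (T v)
    (LinearMap.mem_range_self T v)
  rw [LinearMap.adjoint_inner_left, LinearMap.adjoint_inner_left, hu]
  rw [inner_sub_left] at horth
  linarith

theorem forall_norm_sub_apply_le_iff (T : E →ₗ[ℝ] F) (b : F) (θ : E) :
    (∀ θ', ‖b - T θ‖ ≤ ‖b - T θ'‖) ↔ T.adjoint (T θ) = T.adjoint b := by
  have hmin : (∀ θ', ‖b - T θ‖ ≤ ‖b - T θ'‖) ↔
      ‖b - T θ‖ = ⨅ w : (LinearMap.range T : Set F), ‖b - w‖ := by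
    have hbdd : BddBelow (Set.range fun w : (LinearMap.range T : Set F) => ‖b - w‖) :=
      ⟨0, Set.forall_mem_range.2 fun _ => norm_nonneg _⟩
    refine ⟨fun h => le_antisymm (le_ciInf ?_) (ciInf_le hbdd ⟨T θ, θ, rfl⟩),
      fun h θ' => h.trans_le (ciInf_le hbdd ⟨T θ', θ', rfl⟩)⟩
    rintro ⟨_, θ', rfl⟩
    exact h θ'
  rw [hmin, Submodule.norm_eq_iInf_iff_real_inner_eq_zero _ (LinearMap.mem_range_self T θ),
    eq_comm, ← sub_eq_zero, ← map_sub]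
  constructor
  · exact fun h => ext_inner_right ℝ fun v => by
      rw [LinearMap.adjoint_inner_left, inner_zero_left, h _ (LinearMap.mem_range_self T v)]
  · rintro h _ ⟨v, rfl⟩
    rw [← LinearMap.adjoint_inner_left, h, inner_zero_left]

theorem exists_inner_ne_zero_of_span_eq_top {E : Type*} [NormedAddCommGroup E]
    [InnerProductSpace ℝ E] {S : Set E} (hS : Submodule.span ℝ S = ⊤) {u : E} (hu : u ≠ 0) :
    ∃ y ∈ S, inner ℝ u y ≠ 0 := by
  by_contra! horth
  have hzero : innerₛₗ ℝ u = 0 := LinearMap.ext_on hS horth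
  exact hu (inner_self_eq_zero.1 (LinearMap.congr_fun hzero u))

end NormalEquations

section DesignMap

variable {ι E : Type*} [NormedAddCommGroup E] [InnerProductSpace ℝ E]

/-- The design matrix with rows `φ i`, as the linear map sending a parameter to its vector of
predicted rewards. -/
def designMap (φ : ι → E) : E →ₗ[ℝ] EuclideanSpace ℝ ι where
  toFun θ := WithLp.toLp 2 fun i => inner ℝ θ (φ i)
  map_add' θ η := by ext i; simp [inner_add_left]
  map_smul' c θ := by ext i; simp [inner_smul_left]

@[simp]
theorem designMap_apply (φ : ι → E) (θ : E) (i : ι) : designMap φ θ i = inner ℝ θ (φ i) := rfl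

theorem adjoint_designMap_apply [Fintype ι] [FiniteDimensional ℝ E] (φ : ι → E)
    (a : EuclideanSpace ℝ ι) : (designMap φ).adjoint a = ∑ i, a i • φ i := by
  refine ext_inner_left ℝ fun θ => ?_
  rw [LinearMap.adjoint_inner_right, inner_sum, PiLp.inner_apply]
  simp [inner_smul_right]

end DesignMap

section EmpiricalWeights

variable {ι α : Type*} [Fintype ι] [Fintype α]

open Classical in
/-- The empirical frequencies of an allocation `x`, as a point of the simplex over `α`. -/
noncomputable def empiricalWeights (x : ι → α) (a : α) : ℝ :=
  ((Finset.univ.filter fun i => x i = a).card : ℝ) / Fintype.card ι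

theorem sum_empiricalWeights_smul {M : Type*} [AddCommGroup M] [Module ℝ M] (x : ι → α)
    (f : α → M) :
    ∑ a, empiricalWeights x a • f a = (Fintype.card ι : ℝ)⁻¹ • ∑ i, f (x i) := by
  classical
  rw [← Finset.sum_fiberwise' Finset.univ x f, Finset.smul_sum]
  refine Finset.sum_congr rfl fun a _ => ?_
  rw [Finset.sum_const, ← Nat.cast_smul_eq_nsmul ℝ, smul_smul, empiricalWeights, div_eq_inv_mul]

theorem empiricalWeights_mem_stdSimplex [Nonempty ι] (x : ι → α) :
    empiricalWeights x ∈ stdSimplex ℝ α := by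
  refine ⟨fun a => by unfold empiricalWeights; positivity, ?_⟩
  simpa using sum_empiricalWeights_smul x fun _ => (1 : ℝ)

end EmpiricalWeights

section Truncation

variable {d e D : ℕ}

/-- The truncation `ψ_d` as a linear map. -/
def truncateₗ (hd : d ≤ D) : EuclideanSpace ℝ (Fin D) →ₗ[ℝ] EuclideanSpace ℝ (Fin d) where
  toFun := truncate hd
  map_add' _ _ := rfl
  map_smul' _ _ := rfl

@[simp]
theorem coe_truncateₗ (hd : d ≤ D) : ⇑(truncateₗ hd) = truncate hd := rfl

theorem truncate_sub (hd : d ≤ D) (y z : EuclideanSpace ℝ (Fin D)) :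
    truncate hd (y - z) = truncate hd y - truncate hd z :=
  map_sub (truncateₗ hd) y z

theorem truncate_truncate (hde : d ≤ e) (heD : e ≤ D) (z : EuclideanSpace ℝ (Fin D)) :
    truncate hde (truncate heD z) = truncate (hde.trans heD) z := rfl

theorem truncate_surjective (hd : d ≤ D) : Function.Surjective (truncate hd) := fun y =>
  let ⟨g, hg⟩ := (Fin.castLE_injective hd).surjective_comp_right y.ofLp
  ⟨WithLp.toLp 2 g, PiLp.ext fun i => congrFun hg i⟩

theorem span_truncate_image_eq_top (hd : d ≤ D) {S : Set (EuclideanSpace ℝ (Fin D))}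
    (hS : Submodule.span ℝ S = ⊤) : Submodule.span ℝ (truncate hd '' S) = ⊤ := by
  rw [← coe_truncateₗ, Submodule.span_image, hS, Submodule.map_top,
    LinearMap.range_eq_top.2 (truncate_surjective hd)]

theorem paramSpace_mono (hde : d ≤ e) : paramSpace D d ⊆ paramSpace D e :=
  fun _ hθ i hi => hθ i (hde.trans hi)

theorem inner_truncate_truncate (hd : d ≤ D) {θ : EuclideanSpace ℝ (Fin D)}
    (hθ : θ ∈ paramSpace D d) (z : EuclideanSpace ℝ (Fin D)) :
    inner ℝ (truncate hd θ) (truncate hd z) = inner ℝ θ z := by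
  obtain ⟨k, rfl⟩ := Nat.exists_eq_add_of_le hd
  have htail : ∀ i : Fin k, θ (Fin.natAdd d i) = 0 := fun i => hθ _ (by simp)
  simp only [PiLp.inner_apply, Fin.sum_univ_add, htail, inner_zero_left, Finset.sum_const_zero,
    add_zero]
  rfl

theorem toLp_inner_eq_designMap {ι : Type*} (hd : d ≤ D) {θ : EuclideanSpace ℝ (Fin D)}
    (hθ : θ ∈ paramSpace D d) (x : ι → EuclideanSpace ℝ (Fin D)) :
    (WithLp.toLp 2 fun i => inner ℝ θ (x i)) = designMap (truncate hd ∘ x) (truncate hd θ) := by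
  ext i
  exact (inner_truncate_truncate hd hθ (x i)).symm

end Truncation

section LeastSquares

variable {d D N : ℕ} {hd : d ≤ D} {x : Fin N → EuclideanSpace ℝ (Fin D)} {r : Fin N → ℝ}
  {θ : EuclideanSpace ℝ (Fin d)}

theorem mem_leastSquares_iff :
    θ ∈ leastSquares hd x r ↔
      (designMap (truncate hd ∘ x)).adjoint (designMap (truncate hd ∘ x) θ) =
        (designMap (truncate hd ∘ x)).adjoint (WithLp.toLp 2 r) := by
  have hloss : ∀ η, ∑ i, (r i - inner ℝ η (truncate hd (x i))) ^ 2 =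
      ‖WithLp.toLp 2 r - designMap (truncate hd ∘ x) η‖ ^ 2 := fun η => by
    simp [EuclideanSpace.norm_sq_eq]
  simp_rw [← forall_norm_sub_apply_le_iff, leastSquares, Set.mem_ofPred_eq, hloss,
    sq_le_sq₀ (norm_nonneg _) (norm_nonneg _)]

theorem leastSquares_nonempty : (leastSquares hd x r).Nonempty :=
  let ⟨θ, hθ, _⟩ := exists_adjoint_apply_apply_eq (designMap (truncate hd ∘ x)) (WithLp.toLp 2 r)
  ⟨θ, mem_leastSquares_iff.2 hθ⟩

theorem add_mem_leastSquares (hθ : θ ∈ leastSquares hd x r) {u : EuclideanSpace ℝ (Fin d)}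
    (hu : designMap (truncate hd ∘ x) u = 0) : θ + u ∈ leastSquares hd x r := by
  rw [mem_leastSquares_iff] at hθ ⊢
  rw [map_add, hu, add_zero, hθ]

theorem designMap_injective_of_leastSquares_eq_singleton (h : leastSquares hd x r = {θ}) :
    Function.Injective (designMap (truncate hd ∘ x)) := by
  refine (injective_iff_map_eq_zero _).2 fun u hu => ?_
  have hmem := add_mem_leastSquares (h.symm ▸ Set.mem_singleton θ) hu
  rwa [h, Set.mem_singleton_iff, add_eq_left] at hmem

theorem inner_adjoint_designMap_of_mem_leastSquares (hθ : θ ∈ leastSquares hd x r)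
    (w : EuclideanSpace ℝ (Fin d)) :
    inner ℝ θ ((designMap (truncate hd ∘ x)).adjoint (designMap (truncate hd ∘ x) w)) =
      inner ℝ (WithLp.toLp 2 r) (designMap (truncate hd ∘ x) w) := by
  rw [LinearMap.adjoint_inner_right, ← LinearMap.adjoint_inner_left,
    mem_leastSquares_iff.1 hθ, LinearMap.adjoint_inner_left]

theorem notMem_bestArms_of_inner_lt_zero {Z : Set (EuclideanSpace ℝ (Fin D))}
    {z zs : EuclideanSpace ℝ (Fin D)} (hz : z ∈ Z)
    (h : inner ℝ θ (truncate hd (zs - z)) < 0) : zs ∉ bestArms hd Z θ := fun hzs => by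
  rw [truncate_sub, inner_sub_right, sub_neg] at h
  exact h.not_ge (hzs.2 z hz)

theorem exists_mem_leastSquares_notMem_bestArms {Z : Set (EuclideanSpace ℝ (Fin D))}
    {zs : EuclideanSpace ℝ (Fin D)} (hZ : Submodule.span ℝ ((fun z => zs - z) '' Z) = ⊤)
    (hinj : ¬ Function.Injective (designMap (truncate hd ∘ x))) :
    ∃ θ ∈ leastSquares hd x r, zs ∉ bestArms hd Z θ := by
  obtain ⟨u, hu, hu_ne⟩ : ∃ u, designMap (truncate hd ∘ x) u = 0 ∧ u ≠ 0 := by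
    simpa [injective_iff_map_eq_zero] using hinj
  obtain ⟨_, ⟨_, ⟨z, hz, rfl⟩, rfl⟩, hinner⟩ :=
    exists_inner_ne_zero_of_span_eq_top (span_truncate_image_eq_top hd hZ) hu_ne
  obtain ⟨θ, hθ⟩ := leastSquares_nonempty (hd := hd) (x := x) (r := r)
  set c : ℝ := -(inner ℝ θ (truncate hd (zs - z)) + 1) / inner ℝ u (truncate hd (zs - z))
  refine ⟨θ + c • u, add_mem_leastSquares hθ (by rw [map_smul, hu, smul_zero]),
    notMem_bestArms_of_inner_lt_zero hz ?_⟩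
  rw [inner_add_left, real_inner_smul_left, div_mul_cancel₀ _ hinner]
  linarith

end LeastSquares

section Complexity

variable {ι : Type*} [Fintype ι] {d D : ℕ} {X : Finset (EuclideanSpace ℝ (Fin D))}

theorem toLp_designMatrix_mulVec (hd : d ≤ D) (l : X → ℝ) (u : EuclideanSpace ℝ (Fin d)) :
    WithLp.toLp 2 ((designMatrix hd X l).mulVec u) =
      ∑ y : X, l y • inner ℝ u (truncate hd y) • truncate hd y := by
  ext j
  simp only [designMatrix, Matrix.sum_mulVec, Matrix.smul_mulVec, Matrix.vecMulVec_mulVec,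
    Finset.sum_apply, Pi.smul_apply, MulOpposite.smul_eq_mul_unop, MulOpposite.unop_op,
    WithLp.ofLp_sum, PiLp.smul_apply, PiLp.inner_apply, smul_eq_mul, dotProduct]
  refine Finset.sum_congr rfl fun y _ => ?_
  simp [mul_comm]

theorem toLp_designMatrix_empiricalWeights_mulVec (hd : d ≤ D) (x : ι → X)
    (u : EuclideanSpace ℝ (Fin d)) :
    WithLp.toLp 2 ((designMatrix hd X (empiricalWeights x)).mulVec u) =
      (Fintype.card ι : ℝ)⁻¹ • (designMap fun i => truncate hd (x i)).adjoint
        (designMap (fun i => truncate hd (x i)) u) := by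
  rw [toLp_designMatrix_mulVec, adjoint_designMap_apply]
  exact sum_empiricalWeights_smul x fun y : X => inner ℝ u (truncate hd y) • truncate hd (y : _)

theorem invNormSq_designMatrix_empiricalWeights_le [Nonempty ι] (hd : d ≤ D) (x : ι → X)
    {a : EuclideanSpace ℝ ι} {y : EuclideanSpace ℝ (Fin d)}
    (hy : ∑ i, a i • truncate hd (x i) = y) :
    invNormSq (designMatrix hd X (empiricalWeights x)) y ≤
      ENNReal.ofReal (Fintype.card ι * ‖a‖ ^ 2) := by
  set T := designMap fun i => truncate hd (x i) with hT
  obtain ⟨u, hu, hnorm⟩ := exists_adjoint_apply_apply_eq T a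
  obtain rfl : T.adjoint (T u) = y := by rw [hu, hT, adjoint_designMap_apply, hy]
  set w : EuclideanSpace ℝ (Fin d) := (Fintype.card ι : ℝ) • u
  have hw : (designMatrix hd X (empiricalWeights x)).mulVec w = T.adjoint (T u) := by
    refine WithLp.toLp_injective 2 ?_
    rw [toLp_designMatrix_empiricalWeights_mulVec, ← hT, map_smul, map_smul,
      inv_smul_smul₀ (by simp)]
  have hdot : w ⬝ᵥ (T.adjoint (T u)).ofLp = Fintype.card ι * ‖T u‖ ^ 2 := by
    rw [← real_inner_self_eq_norm_sq, ← LinearMap.adjoint_inner_right, ← real_inner_smul_left,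
      EuclideanSpace.inner_eq_star_dotProduct, star_trivial, dotProduct_comm]
  refine iInf₂_le_of_le w.ofLp hw (ENNReal.ofReal_le_ofReal ?_)
  rw [hdot]
  gcongr

theorem exists_sq_gap_lt_of_lt_mul_rhoStar [Nonempty ι] {hd : d ≤ D}
    {Z : Set (EuclideanSpace ℝ (Fin D))} {θs zs : EuclideanSpace ℝ (Fin D)}
    {x : ι → EuclideanSpace ℝ (Fin D)} (hx : ∀ i, x i ∈ X) {t : ℝ}
    (hN : (Fintype.card ι : ℝ≥0∞) < ENNReal.ofReal (t ^ 2) * rhoStar hd X Z θs zs) :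
    ∃ z ∈ Z, ∀ a : EuclideanSpace ℝ ι,
      ∑ i, a i • truncate hd (x i) = truncate hd (zs - z) →
        inner ℝ θs (zs - z) ^ 2 < t ^ 2 * ‖a‖ ^ 2 := by
  lift x to ι → X using hx
  have hlt := (ENNReal.div_lt_of_lt_mul' hN).trans_le
    (iInf₂_le (empiricalWeights x) (empiricalWeights_mem_stdSimplex x))
  simp only [lt_iSup_iff] at hlt
  obtain ⟨z, hz, hlt⟩ := hlt
  refine ⟨z, hz.1, fun a ha => ?_⟩
  rw [← WithLp.ofLp_sub, ← truncate_sub, ← inner_sub_right] at hlt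
  have hle := invNormSq_designMatrix_empiricalWeights_le hd x ha
  by_contra! hge
  have ht : ENNReal.ofReal (t ^ 2) ≠ 0 := fun h => by simp [h] at hN
  refine hlt.not_ge (ENNReal.div_le_of_le_mul (hle.trans ?_))
  calc ENNReal.ofReal (Fintype.card ι * ‖a‖ ^ 2)
      = Fintype.card ι / ENNReal.ofReal (t ^ 2) * ENNReal.ofReal (t ^ 2 * ‖a‖ ^ 2) := by
        rw [ENNReal.ofReal_mul (by positivity), ENNReal.ofReal_mul (by positivity),
          ENNReal.ofReal_natCast, ← mul_assoc, ENNReal.div_mul_cancel ht ENNReal.ofReal_ne_top]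
    _ ≤ _ := by gcongr

end Complexity

section ErrorProbability

variable {dstar d D N : ℕ} {X : Finset (EuclideanSpace ℝ (Fin D))}
  {Z : Set (EuclideanSpace ℝ (Fin D))} {θs zs : EuclideanSpace ℝ (Fin D)}
  {x : Fin N → EuclideanSpace ℝ (Fin D)} {Ω : Type*} [MeasurableSpace Ω] {P : Measure Ω}
  {r : Fin N → Ω → ℝ} {t : ℝ}

theorem gaussianReal_Iio_neg_le_measureReal_of_lt_mul_rhoStar (hd : dstar ≤ d) (hdD : d ≤ D)
    (hθs : θs ∈ paramSpace D dstar) (hx : ∀ i, x i ∈ X) [NeZero N]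
    (hinj : Function.Injective (designMap (truncate hdD ∘ x))) (ht : 0 ≤ t)
    (hN : (N : ℝ≥0∞) < ENNReal.ofReal (t ^ 2) * rhoStar (hd.trans hdD) X Z θs zs)
    (hindep : iIndepFun r P)
    (hlaw : ∀ i, HasLaw (r i) (gaussianReal (inner ℝ θs (x i)) 1) P) :
    (gaussianReal 0 1).real (Set.Iio (-t)) ≤
      P.real {ω | ∀ θ ∈ leastSquares hdD x (fun i => r i ω), zs ∉ bestArms hdD Z θ} := by
  have := hindep.isProbabilityMeasure
  obtain ⟨z, hz, hgap⟩ := exists_sq_gap_lt_of_lt_mul_rhoStar hx (by rwa [Fintype.card_fin])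
  set T := designMap (truncate hdD ∘ x) with hT
  obtain ⟨w, hw⟩ : ∃ w, T.adjoint (T w) = truncate hdD (zs - z) :=
    (LinearMap.injective_iff_surjective (f := T.adjoint ∘ₗ T)).1
      ((LinearMap.adjoint_comp_self_injective_iff T).2 hinj) _
  have hmean : inner ℝ (WithLp.toLp 2 fun i => inner ℝ θs (x i)) (T w) =
      inner ℝ θs (zs - z) := by
    have hθs' := paramSpace_mono hd hθs
    rw [toLp_inner_eq_designMap hdD hθs', ← LinearMap.adjoint_inner_right, hw,
      inner_truncate_truncate hdD hθs']
  have hsum : ∑ i, T w i • truncate (hd.trans hdD) (x i) =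
      truncate (hd.trans hdD) (zs - z) := by
    rw [hT, adjoint_designMap_apply] at hw
    simpa only [map_sum, map_smul, coe_truncateₗ, Function.comp_apply, truncate_truncate]
      using congrArg (truncateₗ hd) hw
  have hsnr := hgap _ hsum
  have hTw : T w ≠ 0 := fun h => by
    rw [h, norm_zero] at hsnr
    nlinarith [sq_nonneg (inner ℝ θs (zs - z))]
  have hmean_le : inner ℝ (WithLp.toLp 2 fun i => inner ℝ θs (x i)) (T w) ≤ t * ‖T w‖ := by
    rw [hmean]
    rw [← mul_pow] at hsnr
    exact (lt_of_pow_lt_pow_left₀ 2 (by positivity) hsnr).le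
  refine (gaussianReal_Iio_neg_le_measureReal_inner_lt_zero hindep hlaw hTw hmean_le).trans
    (measureReal_mono fun ω hω θ hθ => notMem_bestArms_of_inner_lt_zero hz ?_)
  rwa [← hw, inner_adjoint_designMap_of_mem_leastSquares hθ]

theorem ne_zero_of_forall_inner_lt [Nontrivial (EuclideanSpace ℝ (Fin D))]
    (hZ : Submodule.span ℝ ((fun z => zs - z) '' Z) = ⊤)
    (hbest : ∀ z ∈ Z, z ≠ zs → inner ℝ θs z < inner ℝ θs zs) : θs ≠ 0 := by
  rintro rfl
  obtain ⟨u, hu⟩ := exists_ne (0 : EuclideanSpace ℝ (Fin D))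
  obtain ⟨_, ⟨z, hz, rfl⟩, hinner⟩ := exists_inner_ne_zero_of_span_eq_top hZ hu
  have hne : z ≠ zs := fun h => hinner (by simp [h])
  simpa using hbest z hz hne

theorem neZero_of_designMap_injective (hdD : d ≤ D) (hθs : θs ∈ paramSpace D d) (hθs0 : θs ≠ 0)
    (hinj : Function.Injective (designMap (truncate hdD ∘ x))) : NeZero N := by
  refine ⟨?_⟩
  rintro rfl
  have htrunc : truncate hdD θs = 0 := hinj (Subsingleton.elim _ _)
  exact hθs0 (inner_self_eq_zero.1 (by
    rw [← inner_truncate_truncate hdD hθs, htrunc, inner_zero_left]))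

theorem gaussianReal_Iio_neg_le_measureReal_of_le_mul_rhoStar (hd : dstar ≤ d) (hdD : d ≤ D)
    (hθs : θs ∈ paramSpace D dstar) (hθs0 : θs ≠ 0) (hx : ∀ i, x i ∈ X)
    (hinj : Function.Injective (designMap (truncate hdD ∘ x))) (ht : 0 ≤ t)
    (hN : (N : ℝ≥0∞) ≤ ENNReal.ofReal (t ^ 2) * rhoStar (hd.trans hdD) X Z θs zs)
    (hindep : iIndepFun r P)
    (hlaw : ∀ i, HasLaw (r i) (gaussianReal (inner ℝ θs (x i)) 1) P) :
    (gaussianReal 0 1).real (Set.Iio (-t)) ≤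
      P.real {ω | ∀ θ ∈ leastSquares hdD x (fun i => r i ω), zs ∉ bestArms hdD Z θ} := by
  have := neZero_of_designMap_injective hdD (paramSpace_mono hd hθs) hθs0 hinj
  -- The supremum over `z` in `rhoStar` need not be attained, so a bad arm is only available for
  -- parameters larger than `t`; left continuity of the Gaussian mass recovers `t` itself.
  refine measureReal_Iio_le_of_forall_lt fun b hb => ?_
  have htb : t < -b := lt_neg_of_lt_neg hb
  rw [← neg_neg b]
  refine gaussianReal_Iio_neg_le_measureReal_of_lt_mul_rhoStar hd hdD hθs hx hinj
    (ht.trans htb.le) ?_ hindep hlaw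
  have hsq : ENNReal.ofReal (t ^ 2) < ENNReal.ofReal ((-b) ^ 2) :=
    (ENNReal.ofReal_lt_ofReal_iff_of_nonneg (by positivity)).2 (by gcongr)
  rcases eq_or_ne (rhoStar (hd.trans hdD) X Z θs zs) ⊤ with htop | htop
  · rw [htop, ENNReal.mul_top (pos_of_gt hsq).ne']
    exact ENNReal.natCast_lt_top N
  · have hρ : rhoStar (hd.trans hdD) X Z θs zs ≠ 0 := fun h => NeZero.ne N (by simpa [h] using hN)
    exact hN.trans_lt ((ENNReal.mul_lt_mul_iff_left hρ htop).2 hsq)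

end ErrorProbability

end LinearBandit

open LinearBandit in
theorem mainTheorem4_general
    {D dstar : ℕ} (hD : 0 < D) (hdstar : dstar ≤ D)
    (X : Finset (EuclideanSpace ℝ (Fin D))) (Z : Set (EuclideanSpace ℝ (Fin D)))
    (θs zs : EuclideanSpace ℝ (Fin D))
    (hZ : Submodule.span ℝ ((fun z => zs - z) '' Z) = ⊤)
    (hzs : zs ∈ Z ∧ ∀ z ∈ Z, z ≠ zs → inner ℝ θs z < inner ℝ θs zs)
    (hθs : θs ∈ paramSpace D dstar)
    (d : ℕ) (hd : dstar ≤ d) (hdD : d ≤ D)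
    (N : ℕ) (x : Fin N → EuclideanSpace ℝ (Fin D)) (hx : ∀ i, x i ∈ X)
    {t : ℝ} (ht : 0 ≤ t)
    (hN : (N : ℝ≥0∞) ≤ ENNReal.ofReal (t ^ 2) * rhoStar hdstar X Z θs zs)
    {Ω : Type*} [MeasurableSpace Ω] (P : Measure Ω) (r : Fin N → Ω → ℝ) (hindep : iIndepFun r P)
    (hlaw : ∀ i, HasLaw (r i) (gaussianReal (inner ℝ θs (x i)) 1) P) :
    (∀ (θhat : Ω → EuclideanSpace ℝ (Fin d)) (zhat : Ω → EuclideanSpace ℝ (Fin D)),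
      (∀ ω, leastSquares hdD x (fun i => r i ω) = {θhat ω}) →
      (∀ ω, zhat ω ∈ bestArms hdD Z (θhat ω)) →
      (gaussianReal 0 1).real (Set.Iio (-t)) ≤ P.real {ω | zhat ω ≠ zs}) ∧
    (gaussianReal 0 1).real (Set.Iio (-t)) ≤
      P.real {ω | ∃ θ ∈ leastSquares hdD x (fun i => r i ω),
        bestArms hdD Z θ ≠ {zs}} := by
  have := hindep.isProbabilityMeasure
  have : Nonempty (Fin D) := ⟨⟨0, hD⟩⟩
  have hθs0 : θs ≠ 0 := ne_zero_of_forall_inner_lt hZ hzs.2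
  have herror := fun hinj =>
    gaussianReal_Iio_neg_le_measureReal_of_le_mul_rhoStar hd hdD hθs hθs0 hx hinj ht hN hindep hlaw
  refine ⟨fun θhat zhat hθhat hzhat => ?_, ?_⟩
  · obtain ⟨ω₀⟩ : Nonempty Ω := P.nonempty_of_neZero
    have hinj := designMap_injective_of_leastSquares_eq_singleton (hθhat ω₀)
    exact (herror hinj).trans (measureReal_mono fun ω hω hmistake =>
      hω (θhat ω) (hθhat ω ▸ rfl) (hmistake ▸ hzhat ω))
  · by_cases hinj : Function.Injective (designMap (truncate hdD ∘ x))
    · exact (herror hinj).trans (measureReal_mono fun ω hω =>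
        have ⟨θ, hθ⟩ := leastSquares_nonempty
        ⟨θ, hθ, fun h => hω θ hθ (h ▸ rfl)⟩)
    · have huniv : {ω | ∃ θ ∈ leastSquares hdD x (fun i => r i ω),
          bestArms hdD Z θ ≠ {zs}} = Set.univ := Set.eq_univ_of_forall fun ω =>
        have ⟨θ, hθ, hnot⟩ := exists_mem_leastSquares_notMem_bestArms hZ hinj
        ⟨θ, hθ, fun h => hnot (h ▸ rfl)⟩
      rw [huniv, probReal_univ]
      exact measureReal_le_one

theorem mainTheorem4
    {D dstar : ℕ} (hD : 0 < D) (hdstar : dstar ≤ D)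
    (X : Finset (EuclideanSpace ℝ (Fin D))) (Z : Set (EuclideanSpace ℝ (Fin D)))
    (θs zs : EuclideanSpace ℝ (Fin D))
    (hX : Submodule.span ℝ (X : Set (EuclideanSpace ℝ (Fin D))) = ⊤)
    (hZ : Submodule.span ℝ ((fun z => zs - z) '' Z) = ⊤)
    (hzs : zs ∈ Z) (hbest : ∀ z ∈ Z, z ≠ zs → inner ℝ θs z < inner ℝ θs zs)
    (hθs : θs ∈ LinearBandit.paramSpace D dstar)
    (δ : ℝ) (hδ0 : 0 < δ) (hδ1 : δ ≤ 0.015)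
    -- the non-interactive algorithm: feature dimension, sample size and fixed allocation
    (d : ℕ) (hd : dstar ≤ d) (hdD : d ≤ D)
    (N : ℕ) (x : Fin N → EuclideanSpace ℝ (Fin D)) (hx : ∀ i, x i ∈ X)
    (hN : (N : ℝ≥0∞) ≤
      ENNReal.ofReal (1 / 2) * LinearBandit.rhoStar hdstar X Z θs zs
        * ENNReal.ofReal (Real.log (1 / δ)))
    -- the independent Gaussian rewards
    {Ω : Type*} [MeasurableSpace Ω] (P : Measure Ω) [IsProbabilityMeasure P]
    (r : Fin N → Ω → ℝ) (hr : ∀ i, Measurable (r i)) (hindep : iIndepFun r P)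
    (hlaw : ∀ i, P.map (r i) = gaussianReal (inner ℝ θs (x i)) 1) :
    -- whenever the least-squares estimator is well defined, the recommendation errs,
    -- however ties in the final maximization are broken
    (∀ (θhat : Ω → EuclideanSpace ℝ (Fin d)) (zhat : Ω → EuclideanSpace ℝ (Fin D)),
      (∀ ω, LinearBandit.leastSquares hdD x (fun i => r i ω) = {θhat ω}) →
      (∀ ω, zhat ω ∈ LinearBandit.bestArms hdD Z (θhat ω)) →
      δ ≤ P.real {ω | zhat ω ≠ zs}) ∧
    -- for every allocation, also one with several least-squares solutions,
    -- least squares fails to single out the best arm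
    δ ≤ P.real {ω | ∃ θ ∈ LinearBandit.leastSquares hdD x (fun i => r i ω),
      LinearBandit.bestArms hdD Z θ ≠ {zs}} := by
  have hδ := LinearBandit.le_gaussianReal_Iio_neg_sqrt_log hδ0 hδ1
  refine (mainTheorem4_general hD hdstar X Z θs zs hZ ⟨hzs, hbest⟩ hθs d hd hdD N x hx
    (Real.sqrt_nonneg _) (hN.trans_eq ?_) P r hindep fun i => ⟨(hr i).aemeasurable, hlaw i⟩).imp
    (fun h θhat zhat hθhat hzhat => hδ.trans (h θhat zhat hθhat hzhat)) hδ.trans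
  have hlog : 0 ≤ Real.log (1 / δ) := Real.log_nonneg (one_le_one_div hδ0 (by linarith))
  rw [mul_right_comm, ← ENNReal.ofReal_mul (by norm_num), Real.sq_sqrt (by positivity),
    one_div_mul_eq_div]
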